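/- Notation and setting. Let $T>0$. For $Z\subseteq\mathbb R^n$ and $c\in\mathbb R^n$ let $V[Z](c)=\sup_{z\in Z}c^\top z$ be the support function, with $V[\varnothing](c)=-\infty$. Let $f:\mathbb R^n\times\mathbb R^m\times\mathbb R^m\to\mathbb R^n$, $(x,u_1,u_2)\mapsto f(x,u_1,u_2)$, be jointly continuous and locally Lipschitz continuous in $x$ (every point $(x,u_1,u_2)$ has a neighbourhood on which $f$ is Lipschitz in $x$ with a constant uniform in the controls), let $\mathbb U_1,\mathbb U_2\subseteq\mathbb R^m$ be non-empty, convex and compact, let $x_0\in\mathbb R^n$, and let $u_1:[0,T]\to\mathbb U_1$ be Lebesgue integrable. For sets $\mathbb X_2(t)\subseteq\mathbb R^n$, the reachable set of Player 2 at time $t\in[0,T]$ is $$X[u_1](t)=\{x(t)\mid x\in \mathbb W_{1,1}^n([0,T]),\ x(0)=x_0,\ \exists u_2\in \mathbb L_1^m([0,T]):\ \dot x(\tau)=f(x(\tau),u_1(\tau),u_2(\tau)),\ x(\tau)\in\mathbb X_2(\tau),\ u_2(\tau)\in\mathbb U_2 \text{ for a.e. }\tau\in[0,T]\}.$$ For $\nu_1\in\mathbb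 R^m$, $c\in\mathbb R^n$ and $Y,Z\subseteq\mathbb R^n$ put $$\Gamma(\nu_1,c,Y,Z)=\{f(\xi,\nu_1,\nu_2)\mid \xi\in Y\cap\operatorname{int}(Z),\ c^\top\xi=V[Y](c),\ \nu_2\in\mathbb U_2\}.$$ For $g:[0,T]\to\mathbb R$ and $t\in(0,T)$ let $\underline{D}g(t)=\liminf_{s\to t}\frac{g(s)-g(t)}{s-t}$ and $\overline{D}g(t)=\limsup_{s\to t}\frac{g(s)-g(t)}{s-t}$; both are equal to $\dot g(t)$ where $g$ is differentiable. Theorem. Let $\mathbb X_2,Y_{\rm B},Y_{\rm F}$ be functions on $[0,T]$ whose values are compact convex subsets of $\mathbb R^n$, such that for every $c\in\mathbb R^n$ the functions $t\mapsto V[Y_{\rm B}(t)](c)$ and $t\mapsto V[Y_{\rm F}(t)](c)$ are Lipschitz continuous on $[0,T]$ and $t\mapsto V[\mathbb X_2(t)](c)$ is continuous on $[0,T]$. Suppose that $$Y_{\rm B}(t)\cap\operatorname{int}(\mathbb X_2(t))\neq\varnothing\quad\text{and}\quad Y_{\rm F}(t)\cap\operatorname{int}(Y_{\rm B}(t))\neq\varnothing\qquad\text{for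 all }t\in[0,T],$$ that for almost every $t\in[0,T]$ the inequalities $$\overline{D}\,V[Y_{\rm B}(\cdot)](c)(t)\le -V[-\Gamma(u_1(t),c,Y_{\rm B}(t),\mathbb X_2(t))](c),\qquad \underline{D}\,V[Y_{\rm F}(\cdot)](c)(t)\ge V[\Gamma(u_1(t),c,Y_{\rm F}(t),Y_{\rm B}(t))](c)$$ hold for all $c\in\mathbb R^n$, and that for all $c\in\mathbb R^n$ $$V[Y_{\rm F}(0)](c)\ge c^\top x_0,\qquad V[Y_{\rm B}(T)](c)\ge V[\mathbb X_2(T)](c).$$ Then $t\mapsto Y_{\rm F}(t)\cap Y_{\rm B}(t)$ is a convex enclosure of $X[u_1]$ on $[0,T]$: for every $t\in[0,T]$ the set $Y_{\rm F}(t)\cap Y_{\rm B}(t)$ is compact and convex, and $X[u_1](t)\subseteq Y_{\rm F}(t)\cap Y_{\rm B}(t)$. -/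

import Mathlib

open Set Filter Topology MeasureTheory
open scoped Pointwise

/-- `ℝⁿ` with the Euclidean norm and inner product. -/
abbrev Rn (n : ℕ) : Type := EuclideanSpace ℝ (Fin n)

/-- The extended real-valued support function `V[Z](c) = sup_{z ∈ Z} cᵀ z`; it is `-∞` for `Z = ∅`. -/
noncomputable def supportFn {n : ℕ} (Z : Set (Rn n)) (c : Rn n) : EReal :=
  ⨆ z ∈ Z, ((inner ℝ c z : ℝ) : EReal)

/-- The function `t ↦ V[Y(t)](c)` of time. It is real-valued when the sets `Y t` are nonempty and
bounded, and only used for such sets. -/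
noncomputable def supportFnTime {n : ℕ} (Y : ℝ → Set (Rn n)) (c : Rn n) (t : ℝ) : ℝ :=
  (supportFn (Y t) c).toReal

/-- The (two-sided) lower Dini derivative `liminf_{s → t} (g s - g t) / (s - t)`. It is equal to
the derivative wherever `g` is differentiable. -/
noncomputable def lowerDini (g : ℝ → ℝ) (t : ℝ) : EReal :=
  liminf (fun s : ℝ => (((g s - g t) / (s - t) : ℝ) : EReal)) (𝓝[≠] t)

/-- The (two-sided) upper Dini derivative `limsup_{s → t} (g s - g t) / (s - t)`. It is equal to
the derivative wherever `g` is differentiable. -/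
noncomputable def upperDini (g : ℝ → ℝ) (t : ℝ) : EReal :=
  limsup (fun s : ℝ => (((g s - g t) / (s - t) : ℝ) : EReal)) (𝓝[≠] t)

/-- `t ↦ V[Y(t)](c)` is Lipschitz continuous on `[0, T]`, for every `c` (the constant may depend
on `c`). -/
def SupportLipschitz {n : ℕ} (T : ℝ) (Y : ℝ → Set (Rn n)) : Prop :=
  ∀ c : Rn n, ∃ L : NNReal, LipschitzOnWith L (supportFnTime Y c) (Icc 0 T)

/-- `t ↦ V[Y(t)](c)` is continuous on `[0, T]`, for every `c`. -/
def SupportContinuous {n : ℕ} (T : ℝ) (Y : ℝ → Set (Rn n)) : Prop :=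
  ∀ c : Rn n, ContinuousOn (supportFnTime Y c) (Icc 0 T)

/-- `f (x, u₁, u₂)` is jointly continuous, and locally Lipschitz continuous in `x`: around each
point the Lipschitz constant is uniform in the controls. -/
def RhsRegular {n m : ℕ} (f : Rn n → Rn m → Rn m → Rn n) : Prop :=
  Continuous (fun p : Rn n × Rn m × Rn m => f p.1 p.2.1 p.2.2) ∧
  ∀ p : Rn n × Rn m × Rn m, ∃ K : ℝ, ∃ S ∈ 𝓝 p, ∀ (x y : Rn n) (a b : Rn m),
    (x, a, b) ∈ S → (y, a, b) ∈ S → ‖f x a b - f y a b‖ ≤ K * ‖x - y‖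

/-- `x` is (the absolutely continuous representative of) a function in the Sobolev space `W_{1,1}`
on `[0, T]`, and the integrable function `v` is its weak derivative. -/
def HasW11Deriv {n : ℕ} (T : ℝ) (x v : ℝ → Rn n) : Prop :=
  IntegrableOn v (Icc 0 T) volume ∧ ∀ t ∈ Icc (0 : ℝ) T, x t = x 0 + ∫ s in (0 : ℝ)..t, v s

/-- The set `𝕏[u₁]` of feasible state trajectories that the second player can realize. -/
def feasibleTrajectories {n m : ℕ} (f : Rn n → Rn m → Rn m → Rn n) (U₂ : Set (Rn m))
    (X₂ : ℝ → Set (Rn n)) (x₀ : Rn n) (T : ℝ) (u₁ : ℝ → Rn m) : Set (ℝ → Rn n) :=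
  {x | ∃ (v : ℝ → Rn n) (u₂ : ℝ → Rn m), HasW11Deriv T x v ∧ IntegrableOn u₂ (Icc 0 T) volume ∧
    (∀ᵐ τ ∂(volume.restrict (Icc (0 : ℝ) T)),
      v τ = f (x τ) (u₁ τ) (u₂ τ) ∧ x τ ∈ X₂ τ ∧ u₂ τ ∈ U₂) ∧
    x 0 = x₀}

/-- The reachable set `X[u₁](t)` of the second player. -/
def reachableSet {n m : ℕ} (f : Rn n → Rn m → Rn m → Rn n) (U₂ : Set (Rn m))
    (X₂ : ℝ → Set (Rn n)) (x₀ : Rn n) (T : ℝ) (u₁ : ℝ → Rn m) (t : ℝ) : Set (Rn n) :=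
  {ξ | ∃ x ∈ feasibleTrajectories f U₂ X₂ x₀ T u₁, x t = ξ}

/-- The set `Γ(ν₁, c, Y, Z)` of velocities on the part of the supporting facet of `Y` in direction
`c` that lies in the interior of `Z`. -/
def velocitySet {n m : ℕ} (f : Rn n → Rn m → Rn m → Rn n) (U₂ : Set (Rn m)) (ν₁ : Rn m)
    (c : Rn n) (Y Z : Set (Rn n)) : Set (Rn n) :=
  {w | ∃ (ξ : Rn n) (ν₂ : Rn m), ((inner ℝ c ξ : ℝ) : EReal) = supportFn Y c ∧
    ξ ∈ Y ∩ interior Z ∧ ν₂ ∈ U₂ ∧ w = f ξ ν₁ ν₂}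

/-- `Y` takes compact convex values on `[0, T]`. -/
def CompactConvexValued {n : ℕ} (T : ℝ) (Y : ℝ → Set (Rn n)) : Prop :=
  ∀ t ∈ Icc (0 : ℝ) T, IsCompact (Y t) ∧ Convex ℝ (Y t)

/-- The compact convex set-valued function `Y` is an enclosure of `Z` on `[0, T]`. -/
def IsEnclosure {n : ℕ} (T : ℝ) (Y Z : ℝ → Set (Rn n)) : Prop :=
  CompactConvexValued T Y ∧ ∀ t ∈ Icc (0 : ℝ) T, Z t ⊆ Y t

/-! ### Support functions, separation, and facets of enlarged convex sets. -/

section SupportFunction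

variable {n : ℕ}

/-! Both inclusions are instances of one invariance principle: a Lipschitz curve that stays in `Z`
and starts in `Y` cannot leave `Y` if each facet of `Y` moves at least as fast as the velocity field
pushes through it. Only facet points in the interior of `Z` need to be tested. A feasible trajectory
stays in `X₂` and ends in `YB`, so the principle with time reversed gives `x t ∈ YB t`. The
principle in forward time, with `YB` now in the role of `Z`, then gives `x t ∈ YF t`.

The principle is proved by a barrier (`mem_of_facet_velocity_le`). Fix `z` with a ball of radius `r`
around it inside `int Z`, and enlarge `Y` to `Y + e (Y - z + r B)`, with `B` the unit ball and `e =
ε exp W`. If `x` first touches the boundary of the enlargement in direction `c`, then `x = ξ + e (ξ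
- z + w)` with `ξ` on the facet of `Y` and `‖w‖ ≤ r`. Hence `ξ` is a proper convex combination of `x
∈ Z` and `z - w ∈ int Z`, and so lies in `int Z` (`exists_facet_point`); this particular shape of
enlargement is what makes the restricted facet condition sufficient. Since `‖x - ξ‖ = O(e)`, the
Lipschitz bound on the field leaves an error `O(e)`, which a sufficiently fast growth of `W` beats.
Letting `ε → 0` gives the claim.

The differential inequalities may fail on a null set of times. There `W` is made to grow infinitely
fast (`exists_continuous_growth`), which excludes a first contact because the curve and the support
functions are Lipschitz in time. A fixed `z` works only for a short time;
`forall_mem_of_facet_velocity_le` continues the result to the whole interval. -/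

theorem exists_inner_eq_supportFn {Z : Set (Rn n)} (hZ : IsCompact Z) (hne : Z.Nonempty)
    (c : Rn n) : ∃ z ∈ Z, (∀ y ∈ Z, inner ℝ c y ≤ inner ℝ c z) ∧
      supportFn Z c = ((inner ℝ c z : ℝ) : EReal) := by
  obtain ⟨z, hz, hmax⟩ := hZ.exists_isMaxOn hne
    (f := fun y => (inner ℝ c y : ℝ)) (by fun_prop)
  refine ⟨z, hz, fun y hy => hmax hy, le_antisymm ?_ ?_⟩
  · exact iSup₂_le fun y hy => EReal.coe_le_coe_iff.2 (hmax hy)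
  · exact le_iSup₂_of_le z hz le_rfl

theorem coe_toReal_supportFn {Z : Set (Rn n)} (hZ : IsCompact Z) (hne : Z.Nonempty) (c : Rn n) :
    (((supportFn Z c).toReal : ℝ) : EReal) = supportFn Z c := by
  obtain ⟨z, -, -, h⟩ := exists_inner_eq_supportFn hZ hne c
  rw [h, EReal.toReal_coe]

theorem inner_le_toReal_supportFn {Z : Set (Rn n)} (hZ : IsCompact Z) {z : Rn n} (hz : z ∈ Z)
    (c : Rn n) : inner ℝ c z ≤ (supportFn Z c).toReal := by
  obtain ⟨y, -, hy, h⟩ := exists_inner_eq_supportFn hZ ⟨z, hz⟩ c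
  rw [h, EReal.toReal_coe]
  exact hy z hz

theorem exists_inner_eq_toReal_supportFn {Z : Set (Rn n)} (hZ : IsCompact Z) (hne : Z.Nonempty)
    (c : Rn n) : ∃ z ∈ Z, inner ℝ c z = (supportFn Z c).toReal := by
  obtain ⟨z, hz, -, h⟩ := exists_inner_eq_supportFn hZ hne c
  exact ⟨z, hz, by rw [h, EReal.toReal_coe]⟩

/-- Hahn–Banach separation, with the separating functional normalized. Nonemptiness cannot be
dropped: in dimension zero there are no unit vectors to test. -/
theorem mem_of_forall_unit_exists_inner_le {S : Set (Rn n)} (hS : IsClosed S)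
    (hconv : Convex ℝ S) (hne : S.Nonempty) {x : Rn n}
    (h : ∀ c : Rn n, ‖c‖ = 1 → ∃ s ∈ S, inner ℝ c x ≤ inner ℝ c s) : x ∈ S := by
  by_contra hx
  obtain ⟨F, u, hF, hu⟩ := geometric_hahn_banach_closed_point hconv hS hx
  set d := (InnerProductSpace.toDual ℝ (Rn n)).symm F with hd
  have hin : ∀ y, inner ℝ d y = F y := fun y => InnerProductSpace.toDual_symm_apply
  have hd0 : d ≠ 0 := by
    intro h0
    obtain ⟨s, hs⟩ := hne
    have h1 := hF s hs
    rw [← hin] at h1 hu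
    simp only [h0, inner_zero_left] at h1 hu
    linarith
  have hpos : 0 < ‖d‖ := norm_pos_iff.2 hd0
  obtain ⟨s, hs, hle⟩ := h (‖d‖⁻¹ • d) (by rw [norm_smul, norm_inv, norm_norm]; field_simp)
  rw [real_inner_smul_left, real_inner_smul_left, hin, hin] at hle
  have := le_of_mul_le_mul_left hle (inv_pos.2 hpos)
  linarith [hF s hs]

theorem mem_of_forall_unit_inner_le_supportFn {S : Set (Rn n)} (hS : IsCompact S)
    (hconv : Convex ℝ S) (hne : S.Nonempty) {x : Rn n}
    (h : ∀ c : Rn n, ‖c‖ = 1 → inner ℝ c x ≤ (supportFn S c).toReal) : x ∈ S := by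
  refine mem_of_forall_unit_exists_inner_le hS.isClosed hconv hne fun c hc => ?_
  obtain ⟨z, hz, hzc⟩ := exists_inner_eq_toReal_supportFn hS hne c
  exact ⟨z, hz, hzc ▸ h c hc⟩

/-- A supremum of linear functionals of norm at most `R`. The constant depends only on the radius,
so it is uniform in time for uniformly bounded values, and separate continuity becomes joint
continuity. -/
theorem lipschitzWith_toReal_supportFn {Z : Set (Rn n)} (hZ : IsCompact Z) (hne : Z.Nonempty)
    {R : NNReal} (hR : ∀ z ∈ Z, ‖z‖ ≤ R) :
    LipschitzWith R (fun c => (supportFn Z c).toReal) := by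
  refine LipschitzWith.of_le_add_mul R fun c d => ?_
  obtain ⟨z, hz, hzc⟩ := exists_inner_eq_toReal_supportFn hZ hne c
  have h1 := inner_le_toReal_supportFn hZ hz d
  have h2 : inner ℝ c z = inner ℝ d z + inner ℝ (c - d) z := by
    rw [← inner_add_left]; simp
  have h3 : inner ℝ (c - d) z ≤ ‖c - d‖ * ‖z‖ := real_inner_le_norm _ _
  have h4 : ‖c - d‖ * ‖z‖ ≤ ‖c - d‖ * R := mul_le_mul_of_nonneg_left (hR z hz) (norm_nonneg _)
  rw [dist_eq_norm, ← hzc]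
  linarith

theorem norm_le_sum_abs (z : Rn n) : ‖z‖ ≤ ∑ i, |z i| := by
  rw [EuclideanSpace.norm_eq]
  refine Real.sqrt_le_iff.2 ⟨Finset.sum_nonneg fun i _ => abs_nonneg _, ?_⟩
  exact Finset.sum_sq_le_sq_sum_of_nonneg fun i _ => abs_nonneg _

/-- The values of a set-valued function with continuous support functions are uniformly bounded. -/
theorem SupportContinuous.exists_norm_le {T : ℝ} {Y : ℝ → Set (Rn n)}
    (hYc : SupportContinuous T Y) (hY : CompactConvexValued T Y) :
    ∃ R : NNReal, ∀ t ∈ Icc (0 : ℝ) T, ∀ z ∈ Y t, ‖z‖ ≤ R := by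
  have hb : ∀ c : Rn n, ∃ B : ℝ, ∀ t ∈ Icc (0 : ℝ) T, ∀ z ∈ Y t, inner ℝ c z ≤ B := by
    intro c
    obtain ⟨B, hB⟩ := isCompact_Icc.bddAbove_image (hYc c)
    exact ⟨B, fun t ht z hz => (inner_le_toReal_supportFn (hY t ht).1 hz c).trans
      (hB ⟨t, ht, rfl⟩)⟩
  choose B hB using hb
  -- The directions `± eᵢ` bound every coordinate, so finitely many support functions suffice.
  refine ⟨(∑ i, max (B (EuclideanSpace.single i 1)) (B (EuclideanSpace.single i (-1)))).toNNReal,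
    fun t ht z hz => ?_⟩
  refine (norm_le_sum_abs z).trans ((Finset.sum_le_sum fun i _ => ?_).trans (Real.le_coe_toNNReal _))
  have h1 := hB (EuclideanSpace.single i 1) t ht z hz
  have h2 := hB (EuclideanSpace.single i (-1)) t ht z hz
  simp only [EuclideanSpace.inner_single_left, map_one, map_neg, one_mul, neg_mul] at h1 h2
  exact abs_le'.2 ⟨h1.trans (le_max_left _ _), h2.trans (le_max_right _ _)⟩

/-- Support functions that are continuous in time are jointly continuous. -/
theorem SupportContinuous.continuousOn_uncurry {T : ℝ} {Y : ℝ → Set (Rn n)}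
    (hYc : SupportContinuous T Y) (hY : CompactConvexValued T Y)
    (hne : ∀ t ∈ Icc (0 : ℝ) T, (Y t).Nonempty) :
    ContinuousOn (fun p : ℝ × Rn n => supportFnTime Y p.2 p.1) (Icc 0 T ×ˢ univ) := by
  obtain ⟨R, hR⟩ := hYc.exists_norm_le hY
  have h : ContinuousOn (fun p : Rn n × ℝ => supportFnTime Y p.1 p.2) (univ ×ˢ Icc 0 T) := by
    refine continuousOn_prod_of_continuousOn_lipschitzOnWith _ R (fun c _ => hYc c) fun t ht => ?_
    exact (lipschitzWith_toReal_supportFn (hY t ht).1 (hne t ht) (hR t ht)).lipschitzOnWith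
  have hm : MapsTo (fun p : ℝ × Rn n => (p.2, p.1)) (Icc 0 T ×ˢ univ) (univ ×ˢ Icc 0 T) :=
    fun p hp => mk_mem_prod (mem_univ _) hp.1
  exact h.comp (f := fun p : ℝ × Rn n => (p.2, p.1)) (by fun_prop) hm

theorem SupportLipschitz.supportContinuous {T : ℝ} {Y : ℝ → Set (Rn n)}
    (h : SupportLipschitz T Y) : SupportContinuous T Y := fun c => by
  obtain ⟨L, hL⟩ := h c
  exact hL.continuousOn

/-- The times at which some unit vector makes a jointly continuous function nonnegative form a
compact set. -/
theorem isCompact_setOf_exists_unit_nonneg {a b : ℝ} {H : ℝ × Rn n → ℝ}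
    (hH : ContinuousOn H (Icc a b ×ˢ univ)) :
    IsCompact {t | t ∈ Icc a b ∧ ∃ c : Rn n, ‖c‖ = 1 ∧ 0 ≤ H (t, c)} := by
  have hK : IsCompact (Icc a b ×ˢ Metric.sphere (0 : Rn n) 1) :=
    isCompact_Icc.prod (isCompact_sphere _ _)
  have hC := (hH.mono (prod_mono_right (subset_univ (Metric.sphere (0 : Rn n) 1)))).preimage_isClosed_of_isClosed
    hK.isClosed (isClosed_Ici (a := (0 : ℝ)))
  have h := ((hK.of_isClosed_subset hC inter_subset_left).image continuous_fst)
  convert h using 1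
  ext t
  constructor
  · rintro ⟨ht, c, hc, hn⟩
    exact ⟨(t, c), ⟨⟨ht, by simpa using hc⟩, hn⟩, rfl⟩
  · rintro ⟨⟨s, c⟩, ⟨⟨hs, hc⟩, hn⟩, rfl⟩
    exact ⟨hs, c, by simpa using hc, hn⟩

/-- If `x` is on the boundary of the enlargement `(1 + e) Y - e z + e B` of `Y`, where `B` is the
ball of radius `r`, then it is close to a point of the facet of `Y` in the same direction, and this
point is in the interior of `Z` if `x ∈ Z` and the ball of radius `r` around `z` is. -/
theorem exists_facet_point {Y Z : Set (Rn n)} (hY : IsCompact Y) (hYc : Convex ℝ Y)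
    (hne : Y.Nonempty) (hZ : Convex ℝ Z) {x z c : Rn n} {e r : ℝ} (he : 0 < e) (hr : 0 ≤ r)
    (hx : x ∈ Z) (hz : Metric.closedBall z r ⊆ interior Z)
    (hle : ∀ d : Rn n, ‖d‖ = 1 → inner ℝ d x - (supportFn Y d).toReal
      ≤ e * ((supportFn Y d).toReal - inner ℝ d z + r)) (hc : ‖c‖ = 1)
    (heq : e * ((supportFn Y c).toReal - inner ℝ c z + r) ≤
      inner ℝ c x - (supportFn Y c).toReal) :
    ∃ ξ ∈ Y ∩ interior Z, inner ℝ c ξ = (supportFn Y c).toReal ∧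
      ‖x - ξ‖ ≤ e * (‖ξ‖ + ‖z‖ + r) := by
  -- The enlargement is a convex image of `Y × ball`, in which both copies of `Y` use the same
  -- point; convexity of `Y` makes this equivalent to independent copies.
  have hQ : x ∈ (fun p : Rn n × Rn n => p.1 + e • (p.1 - z + p.2)) ''
      (Y ×ˢ Metric.closedBall (0 : Rn n) r) := by
    have hcomp : IsCompact (Y ×ˢ Metric.closedBall (0 : Rn n) r) :=
      hY.prod (isCompact_closedBall _ _)
    refine mem_of_forall_unit_exists_inner_le (hcomp.image (by fun_prop)).isClosed ?_ ?_ ?_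
    · rintro _ ⟨p, hp, rfl⟩ _ ⟨q, hq, rfl⟩ α β hα hβ hαβ
      refine ⟨α • p + β • q,
        (hYc.prod (convex_closedBall (0 : Rn n) r)) hp hq hα hβ hαβ, ?_⟩
      have hz' : z = α • z + β • z := by rw [← add_smul, hαβ, one_smul]
      simp only [Prod.fst_add, Prod.snd_add, Prod.smul_fst, Prod.smul_snd]
      conv_lhs => rw [hz']
      module
    · exact (hne.prod ⟨0, by simpa using hr⟩).image _
    · intro d hd
      obtain ⟨y, hy, hyd⟩ := exists_inner_eq_toReal_supportFn hY hne d
      refine ⟨_, ⟨(y, r • d), ⟨hy, by simp [norm_smul, hd, abs_of_nonneg hr]⟩, rfl⟩, ?_⟩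
      have h1 := hle d hd
      simp only [inner_add_right, inner_smul_right, inner_sub_right, real_inner_self_eq_norm_sq,
        hd, hyd]
      linarith
  obtain ⟨⟨ξ, w⟩, ⟨hξ, hw⟩, rfl⟩ := hQ
  simp only [mem_closedBall_zero_iff] at hw
  simp only at *
  refine ⟨ξ, ⟨hξ, ?_⟩, ?_, ?_⟩
  · have hzw : z - w ∈ interior Z := hz (by simpa [dist_eq_norm] using hw)
    have h1e : 0 < 1 + e := by linarith
    -- Solving `x = ξ + e (ξ - z + w)` for `ξ` gives weights `1 / (1 + e)` on `x` and `e / (1 + e)`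
    -- on `z - w`.
    have := hZ.combo_self_interior_mem_interior hx hzw (a := 1 / (1 + e)) (b := e / (1 + e))
      (by positivity) (by positivity) (by field_simp)
    convert this using 1
    rw [← sub_eq_zero]
    have : (1 + e) • (ξ - ((1 / (1 + e)) • (ξ + e • (ξ - z + w)) + (e / (1 + e)) • (z - w))) = 0 := by
      rw [smul_sub, smul_add, smul_smul, smul_smul, mul_one_div_cancel h1e.ne',
        mul_div_cancel₀ _ h1e.ne']
      module
    exact (smul_eq_zero.1 this).resolve_left h1e.ne'
  · have h1 := inner_le_toReal_supportFn hY hξ c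
    have h2 : inner ℝ c w ≤ r := (real_inner_le_norm c w).trans (by rw [hc, one_mul]; exact hw)
    -- Contact in direction `c` makes both upper bounds sharp, in particular the one for `ξ`.
    simp only [inner_add_right, inner_smul_right, inner_sub_right] at heq
    nlinarith
  · rw [add_sub_cancel_left, norm_smul, Real.norm_of_nonneg he.le]
    refine mul_le_mul_of_nonneg_left ((norm_add_le _ _).trans (add_le_add (norm_sub_le _ _) hw)) he.le

end SupportFunction

/-! ### A growth function that absorbs exceptional null sets. -/

/-- A continuous function that grows at least at the rate `κ`, and infinitely fast at the points of
a given null set. -/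
theorem exists_continuous_growth {N : Set ℝ} (hN : volume N = 0) (a b : ℝ) (κ : ℝ) :
    ∃ W : ℝ → ℝ, ContinuousOn W (Icc a b) ∧ (∀ t ∈ Ioc a b, ∀ M : ℝ, (t ∈ N ∨ M < κ) →
      ∀ᶠ s in 𝓝[<] t, M * (t - s) ≤ W t - W s) := by
  classical
  set μ := volume.restrict (Icc a b) with hμ
  set N' := toMeasurable volume N with hN'
  have hN'0 : volume N' = 0 := by rw [hN', measure_toMeasurable, hN]
  have hN'm : MeasurableSet N' := measurableSet_toMeasurable _ _
  set f : ℝ → ENNReal := N'.indicator (fun _ => ⊤) + fun _ => ENNReal.ofReal κ with hf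
  have hfm : Measurable f := (measurable_const.indicator hN'm).add measurable_const
  -- Vitali–Carathéodory: `g` is an integrable lower semicontinuous majorant. Its primitive is
  -- continuous, and a strict lower bound for `g` at `t` persists near `t`, even where `g t = ⊤`.
  obtain ⟨g, hfg, hlsc, hg⟩ := exists_le_lowerSemicontinuous_lintegral_ge μ f hfm one_ne_zero
  have hμN : volume (N' ∩ Icc a b) = 0 := measure_inter_null_of_null_left _ hN'0
  have hfin : ∫⁻ x, g x ∂μ ≠ ⊤ := by
    refine ne_top_of_le_ne_top ?_ hg
    rw [hf]
    simp only [Pi.add_apply]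
    rw [lintegral_add_left (measurable_const.indicator hN'm), lintegral_indicator hN'm]
    simp [hμN, hμ, ENNReal.mul_eq_top]
  have hgm : Measurable g := hlsc.measurable
  have hint : IntegrableOn (fun x => (g x).toReal) (Icc a b) volume :=
    integrable_toReal_of_lintegral_ne_top hgm.aemeasurable hfin
  have hlt : ∀ᵐ x, x ∈ Icc a b → g x < ⊤ :=
    (ae_restrict_iff' measurableSet_Icc).1 (ae_lt_top hgm hfin)
  refine ⟨fun t => ∫ s in Ioc a t, (g s).toReal, intervalIntegral.continuousOn_primitive hint, ?_⟩
  intro t ht M hM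
  have hMg : ENNReal.ofReal M < g t ∨ M ≤ 0 := by
    rcases hM with h | h
    · left
      have : f t = ⊤ := by
        simp [hf, indicator_of_mem (subset_toMeasurable volume N h), hN']
      have h2 := hfg t
      rw [this, top_le_iff] at h2
      rw [h2]
      exact ENNReal.ofReal_lt_top
    · by_cases hM0 : M ≤ 0
      · exact Or.inr hM0
      · left
        refine lt_of_lt_of_le ?_ ((le_add_self : ENNReal.ofReal κ ≤ f t).trans (hfg t))
        exact (ENNReal.ofReal_lt_ofReal_iff (by linarith)).2 h
  have hev : ∀ᶠ s in 𝓝 t, ENNReal.ofReal M ≤ g s := by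
    rcases hMg with h | h
    · exact (hlsc t _ h).mono fun s hs => hs.le
    · simp [ENNReal.ofReal_of_nonpos h]
  obtain ⟨δ, hδ, hball⟩ := Metric.eventually_nhds_iff.1 hev
  filter_upwards [Ioo_mem_nhdsLT (show max a (t - δ) < t from max_lt ht.1 (by linarith))]
    with s hs
  have has : a < s := (le_max_left _ _).trans_lt hs.1
  have hsub : Ioc a t = Ioc a s ∪ Ioc s t := (Ioc_union_Ioc_eq_Ioc has.le hs.2.le).symm
  have hint' : IntegrableOn (fun x => (g x).toReal) (Ioc s t) volume :=
    hint.mono_set fun y hy => ⟨(has.trans hy.1).le, hy.2.trans ht.2⟩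
  have hint'' : IntegrableOn (fun x => (g x).toReal) (Ioc a s) volume :=
    hint.mono_set fun y hy => ⟨hy.1.le, hy.2.trans (hs.2.le.trans ht.2)⟩
  rw [hsub, setIntegral_union (Ioc_disjoint_Ioc_of_le le_rfl) measurableSet_Ioc hint'' hint',
    add_sub_cancel_left]
  have hc : ∫ _ in Ioc s t, M = M * (t - s) := by
    simp [hs.2.le, mul_comm]
  rw [← hc]
  refine setIntegral_mono_ae_restrict (by simp) hint' ?_
  refine (ae_restrict_iff' measurableSet_Ioc).2 ?_
  filter_upwards [hlt] with y hy hys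
  have hy1 : g y < ⊤ := hy ⟨(has.trans hys.1).le, hys.2.trans ht.2⟩
  have hy2 : ENNReal.ofReal M ≤ g y := by
    refine hball ?_
    have := (le_max_right a (t - δ)).trans_lt hs.1
    rw [Real.dist_eq, abs_lt]
    constructor <;> linarith [hys.1, hys.2]
  exact (ENNReal.ofReal_le_iff_le_toReal hy1.ne).1 hy2

/-! ### Invariance on a short interval: the barrier argument. -/

section Invariance

variable {n : ℕ}

/-- If a jointly continuous function is negative for all unit vectors initially and not later on,
then at the first such time it vanishes for some unit vector, and it is nonpositive for all. -/
theorem exists_first_time {a b : ℝ} {H : ℝ × Rn n → ℝ} (hH : ContinuousOn H (Icc a b ×ˢ univ))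
    (h0 : ∀ c : Rn n, ‖c‖ = 1 → H (a, c) < 0)
    (hex : ∃ t ∈ Icc a b, ∃ c : Rn n, ‖c‖ = 1 ∧ 0 ≤ H (t, c)) :
    ∃ t ∈ Ioc a b, (∃ c : Rn n, ‖c‖ = 1 ∧ 0 ≤ H (t, c)) ∧
      (∀ c : Rn n, ‖c‖ = 1 → H (t, c) ≤ 0) ∧
      ∀ s ∈ Ico a t, ∀ c : Rn n, ‖c‖ = 1 → H (s, c) < 0 := by
  obtain ⟨t', ht', c', hc', hn'⟩ := hex
  have hcomp := isCompact_setOf_exists_unit_nonneg hH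
  obtain ⟨t, ⟨ht, c, hc, hn⟩, hmin⟩ := hcomp.exists_isLeast ⟨t', ht', c', hc', hn'⟩
  have hat : a < t := by
    refine lt_of_le_of_ne ht.1 ?_
    rintro rfl
    exact (h0 c hc).not_ge hn
  have hlt : ∀ s ∈ Ico a t, ∀ c : Rn n, ‖c‖ = 1 → H (s, c) < 0 := by
    intro s hs d hd
    by_contra! hcon
    exact (hmin ⟨⟨hs.1, hs.2.le.trans ht.2⟩, d, hd, hcon⟩).not_gt hs.2
  refine ⟨t, ⟨hat, ht.2⟩, ⟨c, hc, hn⟩, fun d hd => ?_, hlt⟩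
  have hcont : ContinuousWithinAt (fun s => H (s, d)) (Icc a b) t :=
    (hH.comp (f := fun s => (s, d)) (by fun_prop) fun s hs => ⟨hs, mem_univ _⟩) t ht
  have hle : 𝓝[<] t ≤ 𝓝[Icc a b] t :=
    nhdsWithin_le_of_mem (mem_of_superset (Ico_mem_nhdsLT hat) fun s hs =>
      ⟨hs.1, hs.2.le.trans ht.2⟩)
  exact le_of_tendsto (hcont.tendsto.mono_left hle)
    (mem_of_superset (Ico_mem_nhdsLT hat) fun s hs => (hlt s hs d hd).le)

/-- A Lipschitz curve in `Z` that starts in `Y` remains in `Y` if, almost everywhere, the support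
function of `Y` in direction `c` grows at least as fast as the velocity field points outward on the
facet of `Y` in direction `c`, where only points in the interior of `Z` matter. -/
theorem mem_of_facet_velocity_le {a b : ℝ} {Y Z : ℝ → Set (Rn n)}
    (hY : ∀ t ∈ Icc a b, IsCompact (Y t) ∧ Convex ℝ (Y t)) (hYne : ∀ t ∈ Icc a b, (Y t).Nonempty)
    (hZ : ∀ t ∈ Icc a b, Convex ℝ (Z t))
    (hVlip : ∀ c : Rn n, ∃ L : NNReal, LipschitzOnWith L (supportFnTime Y c) (Icc a b))
    (hV : ContinuousOn (fun p : ℝ × Rn n => supportFnTime Y p.2 p.1) (Icc a b ×ˢ univ))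
    {x : ℝ → Rn n} {L : NNReal} (hx : LipschitzOnWith L x (Icc a b))
    (hxZ : ∀ t ∈ Icc a b, x t ∈ Z t) (hxa : x a ∈ Y a)
    {z : Rn n} {r : ℝ} (hr : 0 < r) (hz : ∀ t ∈ Icc a b, Metric.closedBall z r ⊆ interior (Z t))
    (hD : ∀ t ∈ Icc a b, ∀ c : Rn n, ‖c‖ = 1 → r / 2 ≤ supportFnTime Y c t - inner ℝ c z + r)
    {R K M : ℝ} (hR : ∀ t ∈ Icc a b, ∀ y ∈ Y t, ‖y‖ ≤ R) (hxR : ∀ t ∈ Icc a b, ‖x t‖ ≤ R)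
    {φ : ℝ → Rn n → Rn n} {N : Set ℝ} (hN : volume N = 0) (hK : 0 ≤ K)
    (hφ : ∀ t ∈ Icc a b, t ∉ N →
      (∀ ξ η, ‖ξ‖ ≤ R → ‖η‖ ≤ R → ‖φ t ξ - φ t η‖ ≤ K * ‖ξ - η‖) ∧
      (∀ ξ, ‖ξ‖ ≤ R → ‖φ t ξ‖ ≤ M) ∧ HasDerivWithinAt x (φ t (x t)) (Iio t) t ∧
      ∀ c : Rn n, ∀ ξ ∈ Y t ∩ interior (Z t), inner ℝ c ξ = supportFnTime Y c t →
        ∀ q < inner ℝ c (φ t ξ), ∀ᶠ s in 𝓝[<] t,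
          q * (t - s) ≤ supportFnTime Y c t - supportFnTime Y c s) :
    ∀ t ∈ Icc a b, x t ∈ Y t := by
  -- The error at contact, divided by `e`: `K` times the bound for `‖x - ξ‖ / e`, plus `M` for the
  -- surplus factor `e` in `1 + e`.
  set C := K * (R + ‖z‖ + r) + M with hC
  obtain ⟨W, hWc, hW⟩ := exists_continuous_growth hN a b (2 * C / r + 2)
  set D : ℝ × Rn n → ℝ := fun p => supportFnTime Y p.2 p.1 - inner ℝ p.2 z + r with hDdef
  have hDcont : ContinuousOn D (Icc a b ×ˢ univ) := by
    refine (hV.sub ?_).add continuousOn_const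
    fun_prop
  have hxcont : ContinuousOn (fun p : ℝ × Rn n => x p.1) (Icc a b ×ˢ univ) :=
    hx.continuousOn.comp continuousOn_fst fun p hp => hp.1
  have hWcont : ContinuousOn (fun p : ℝ × Rn n => W p.1) (Icc a b ×ˢ univ) :=
    hWc.comp continuousOn_fst fun p hp => hp.1
  have key : ∀ ε > 0, ∀ t ∈ Icc a b, ∀ c : Rn n, ‖c‖ = 1 →
      inner ℝ c (x t) - supportFnTime Y c t - ε * Real.exp (W t) * D (t, c) < 0 := by
    intro ε hε
    set e : ℝ → ℝ := fun t => ε * Real.exp (W t) with he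
    have hepos : ∀ t, 0 < e t := fun t => by positivity
    set H : ℝ × Rn n → ℝ := fun p => inner ℝ p.2 (x p.1) - supportFnTime Y p.2 p.1
      - e p.1 * D p with hH
    have hHcont : ContinuousOn H (Icc a b ×ˢ univ) := by
      refine ((ContinuousOn.inner continuousOn_snd hxcont).sub hV).sub (ContinuousOn.mul ?_ hDcont)
      exact continuousOn_const.mul hWcont.rexp
    by_contra! hcon
    obtain ⟨t', ht', c', hc', hn'⟩ := hcon
    have hab : a ≤ b := ht'.1.trans ht'.2
    have ha : a ∈ Icc a b := left_mem_Icc.2 hab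
    obtain ⟨t, ht, ⟨c, hc, hge⟩, hle, hlt⟩ := exists_first_time hHcont (fun c hc => by
      have h1 := inner_le_toReal_supportFn (hY a ha).1 hxa c
      have h2 : r / 2 ≤ D (a, c) := hD a ha c hc
      have h3 : 0 < e a * D (a, c) := mul_pos (hepos a) (by linarith)
      simp only [hH]
      have h4 : supportFnTime Y c a = (supportFn (Y a) c).toReal := rfl
      linarith) ⟨t', ht', c', hc', hn'⟩
    have ht1 : t ∈ Icc a b := ⟨ht.1.le, ht.2⟩
    obtain ⟨Lc, hLc⟩ := hVlip c
    have hIco : ∀ᶠ s in 𝓝[<] t, s ∈ Ico a t := Ico_mem_nhdsLT ht.1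
    -- The growth of the barrier exceeds any rate allowed by the choice of `W`.
    have hgrow : ∀ m, 0 ≤ m → (t ∈ N ∨ m < 2 * C / r + 2) → ∀ᶠ s in 𝓝[<] t,
        e s * (m * (r / 2)) * (t - s) ≤ inner ℝ c (x t - x s)
          - (1 + e t) * (supportFnTime Y c t - supportFnTime Y c s) := by
      intro m hm hmN
      filter_upwards [hW t ht m hmN, hIco] with s hs hsI
      have hsab : s ∈ Icc a b := ⟨hsI.1, hsI.2.le.trans ht.2⟩
      -- Subtract `H (s, c) < 0` from `H (t, c) ≥ 0` and split `e t * D t - e s * D s` as `e t * (D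
      -- t - D s) + (e t - e s) * D s`; the increment of `D` is that of the support function.
      have h1 := hlt s hsI c hc
      have h2 : r / 2 ≤ D (s, c) := hD s hsab c hc
      have h3 : e s * (m * (t - s)) ≤ e t - e s := by
        have h4 : W t - W s + 1 ≤ Real.exp (W t - W s) := Real.add_one_le_exp _
        have h5 : e t = e s * Real.exp (W t - W s) := by
          simp only [he]
          rw [mul_assoc, ← Real.exp_add]
          ring_nf
        rw [h5]
        nlinarith [hepos s]
      have h6 : 0 ≤ e s * (m * (t - s)) :=
        mul_nonneg (hepos s).le (mul_nonneg hm (by linarith [hsI.2]))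
      have h7 : e s * (m * (t - s)) * (r / 2) ≤ (e t - e s) * D (s, c) :=
        mul_le_mul h3 h2 (by positivity) (h6.trans h3)
      simp only [hH, hDdef] at hge h1 h7
      rw [inner_sub_right]
      nlinarith
    have hetend : Tendsto e (𝓝[<] t) (𝓝 (e t)) := by
      have h1 : ContinuousOn e (Icc a b) := continuousOn_const.mul hWc.rexp
      exact (h1 t ht1).tendsto.mono_left (nhdsWithin_le_of_mem
        (mem_of_superset (Ico_mem_nhdsLT ht.1) fun s hs => ⟨hs.1, hs.2.le.trans ht.2⟩))
    have hehalf : ∀ᶠ s in 𝓝[<] t, e t / 2 < e s :=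
      hetend.eventually_const_lt (by linarith [hepos t])
    by_cases htN : t ∈ N
    -- At an exceptional time the right side of `hgrow` is at most `B * (t - s)`, while `m` is
    -- chosen to make the left side at least `(B + 1) * (t - s)`.
    · set B : ℝ := L + (1 + e t) * Lc with hB
      have hB0 : 0 ≤ B := add_nonneg L.2 (mul_nonneg (by linarith [hepos t]) Lc.2)
      have hm0 : 0 ≤ (B + 1) / (e t / 2 * (r / 2)) :=
        div_nonneg (by linarith) (mul_nonneg (by linarith [hepos t]) (by linarith))
      have hfalse : ∀ᶠ s in 𝓝[<] t, False := by
        filter_upwards [hgrow _ hm0 (Or.inl htN), hIco, hehalf] with s hs hsI hse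
        have hsab : s ∈ Icc a b := ⟨hsI.1, hsI.2.le.trans ht.2⟩
        have hts : 0 < t - s := by linarith [hsI.2]
        have h1 : inner ℝ c (x t - x s) ≤ L * (t - s) := by
          have h2 := hx.dist_le_mul t ht1 s hsab
          rw [dist_eq_norm, Real.dist_eq, abs_of_pos hts] at h2
          have h3 := real_inner_le_norm c (x t - x s)
          rw [hc, one_mul] at h3
          exact h3.trans h2
        have h4 : -(Lc * (t - s)) ≤ supportFnTime Y c t - supportFnTime Y c s := by
          have h5 := hLc.dist_le_mul t ht1 s hsab
          rw [Real.dist_eq, Real.dist_eq, abs_of_pos hts] at h5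
          exact (abs_le.1 h5).1
        have h6 : (B + 1) ≤ e s * ((B + 1) / (e t / 2 * (r / 2)) * (r / 2)) := by
          have h7 : B + 1 = e t / 2 * ((B + 1) / (e t / 2 * (r / 2)) * (r / 2)) := by
            have := (hepos t).ne'
            field_simp
          calc B + 1 = _ := h7
            _ ≤ _ := mul_le_mul_of_nonneg_right hse.le (mul_nonneg hm0 (by linarith))
        have h8 := mul_le_mul_of_nonneg_right h6 hts.le
        have h9 : (1 + e t) * -(Lc * (t - s)) ≤
            (1 + e t) * (supportFnTime Y c t - supportFnTime Y c s) :=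
          mul_le_mul_of_nonneg_left h4 (by linarith [hepos t])
        nlinarith
      exact hfalse.exists.elim fun _ h => h
    · obtain ⟨hφlip, hφb, hder, hfac⟩ := hφ t ht1 htN
      obtain ⟨ξ, hξ, hξc, hξx⟩ := exists_facet_point (hY t ht1).1 (hY t ht1).2 (hYne t ht1)
        (hZ t ht1) (hepos t) hr.le (hxZ t ht1) (hz t ht1)
        (fun d hd => by
          have := hle d hd
          simp only [hH, hDdef, supportFnTime] at this
          linarith) hc (by
          simp only [hH, hDdef, supportFnTime] at hge
          linarith)
      have hξR := hR t ht1 ξ hξ.1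
      have hR0 : 0 ≤ R := (norm_nonneg _).trans hξR
      have hC0 : 0 ≤ C := by
        have := (norm_nonneg _).trans (hφb ξ hξR)
        have : 0 ≤ R + ‖z‖ + r := by positivity
        positivity
      -- the limit inequality
      have hmain : inner ℝ c (φ t (x t)) - (1 + e t) * inner ℝ c (φ t ξ) ≤ e t * C := by
        have h1 : inner ℝ c (φ t (x t) - φ t ξ) ≤ K * (e t * (R + ‖z‖ + r)) := by
          have h2 := real_inner_le_norm c (φ t (x t) - φ t ξ)
          rw [hc, one_mul] at h2
          refine h2.trans ((hφlip _ _ (hxR t ht1) hξR).trans (mul_le_mul_of_nonneg_left ?_ hK))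
          exact hξx.trans (mul_le_mul_of_nonneg_left (by linarith) (hepos t).le)
        have h3 : -M ≤ inner ℝ c (φ t ξ) := by
          have h4 := abs_real_inner_le_norm c (φ t ξ)
          rw [hc, one_mul] at h4
          exact (abs_le.1 (h4.trans (hφb ξ hξR))).1
        rw [inner_sub_right] at h1
        have h5 := mul_le_mul_of_nonneg_left h3 (hepos t).le
        rw [hC]
        linarith
      -- With this rate the barrier gains `e * (C + r / 2)`. The loss in `q` costs only `e * r / 8`
      -- after multiplication by `1 + e`, so the limit contradicts `hmain`.
      set m := 2 * C / r + 1 with hm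
      have hm0 : 0 ≤ m := by positivity
      set q := inner ℝ c (φ t ξ) - e t * r / (8 * (1 + e t)) with hq
      have h1e : 0 < 1 + e t := by linarith [hepos t]
      have hqlt : q < inner ℝ c (φ t ξ) := by
        have : 0 < e t * r / (8 * (1 + e t)) := by have := hepos t; positivity
        linarith
      have hslope : Tendsto (fun s => inner ℝ c ((s - t)⁻¹ • (x s - x t))) (𝓝[<] t)
          (𝓝 (inner ℝ c (φ t (x t)))) := by
        have h1 := (hasDerivWithinAt_iff_tendsto_slope' (by simp)).1 hder
        exact (tendsto_const_nhds.inner h1)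
      have hev : ∀ᶠ s in 𝓝[<] t, e s * (m * (r / 2)) ≤
          inner ℝ c ((s - t)⁻¹ • (x s - x t)) - (1 + e t) * q := by
        filter_upwards [hgrow m hm0 (Or.inr (by rw [hm]; linarith)), hfac c ξ hξ hξc q hqlt, hIco]
          with s hs hs2 hsI
        have hts : 0 < t - s := by linarith [hsI.2]
        have h1 : (s - t)⁻¹ • (x s - x t) = (t - s)⁻¹ • (x t - x s) := by
          rw [← neg_sub t s, ← neg_sub (x t) (x s), inv_neg, neg_smul_neg]
        have h2 : (t - s) * inner ℝ c ((s - t)⁻¹ • (x s - x t)) = inner ℝ c (x t - x s) := by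
          rw [h1, inner_smul_right]
          field_simp
        have h3 := mul_le_mul_of_nonneg_left hs2 h1e.le
        refine le_of_mul_le_mul_left ?_ hts
        rw [mul_sub, h2]
        linarith
      have hlim := le_of_tendsto_of_tendsto (hetend.mul_const (m * (r / 2)))
        (hslope.sub_const ((1 + e t) * q)) hev
      have h2 : (1 + e t) * q = (1 + e t) * inner ℝ c (φ t ξ) - e t * r / 8 := by
        rw [hq]
        field_simp
      have h3 : e t * (m * (r / 2)) = e t * C + e t * r / 2 := by
        rw [hm]
        field_simp
      have h4 : 0 < e t * r := mul_pos (hepos t) hr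
      rw [h2, h3] at hlim
      linarith
  intro t ht
  refine mem_of_forall_unit_inner_le_supportFn (hY t ht).1 (hY t ht).2 (hYne t ht) fun c hc => ?_
  have hlim : Tendsto (fun ε : ℝ => inner ℝ c (x t) - supportFnTime Y c t
      - ε * Real.exp (W t) * D (t, c)) (𝓝[>] 0)
      (𝓝 (inner ℝ c (x t) - supportFnTime Y c t - 0 * Real.exp (W t) * D (t, c))) := by
    refine Tendsto.mono_left (Continuous.tendsto ?_ 0) nhdsWithin_le_nhds
    fun_prop
  have := le_of_tendsto hlim (mem_of_superset self_mem_nhdsWithin fun ε hε => (key ε hε t ht c hc).le)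
  simp only [zero_mul, sub_zero, sub_nonpos] at this
  exact this

end Invariance

/-! ### From short intervals to the whole time horizon. -/

section Global

variable {n : ℕ}

/-- The barrier argument looks back from the first contact, so only the left half of the two-sided
Dini derivative is needed. -/
theorem eventually_le_sub_of_le_lowerDini {g : ℝ → ℝ} {t p q : ℝ}
    (h : (p : EReal) ≤ lowerDini g t) (hq : q < p) :
    ∀ᶠ s in 𝓝[<] t, q * (t - s) ≤ g t - g s := by
  have h1 : (q : EReal) < lowerDini g t := (EReal.coe_lt_coe_iff.2 hq).trans_le h
  have h2 := (eventually_lt_of_lt_liminf h1).filter_mono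
    (nhdsWithin_mono t fun s (hs : s < t) => hs.ne)
  filter_upwards [h2, self_mem_nhdsWithin] with s hs hst
  have hts : 0 < t - s := sub_pos.2 hst
  have h3 := (EReal.coe_lt_coe_iff.1 hs).le
  rw [← neg_sub (g t), ← neg_sub t, neg_div_neg_eq, le_div_iff₀ hts] at h3
  exact h3

theorem closedBall_subset_of_supportFn {S : Set (Rn n)} (hS : IsCompact S) (hconv : Convex ℝ S)
    (hne : S.Nonempty) {z : Rn n} {r : ℝ}
    (h : ∀ c : Rn n, ‖c‖ = 1 → inner ℝ c z + r ≤ (supportFn S c).toReal) :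
    Metric.closedBall z r ⊆ S := by
  intro y hy
  refine mem_of_forall_unit_inner_le_supportFn hS hconv hne fun c hc => (le_trans ?_ (h c hc))
  have h1 := real_inner_le_norm c (y - z)
  rw [hc, one_mul, inner_sub_right] at h1
  have h2 : ‖y - z‖ ≤ r := by simpa [dist_eq_norm] using hy
  linarith

theorem inner_add_le_supportFn_of_closedBall_subset {S : Set (Rn n)} (hS : IsCompact S) {z : Rn n}
    {r : ℝ} (hr : 0 ≤ r) (h : Metric.closedBall z r ⊆ S) {c : Rn n} (hc : ‖c‖ = 1) :
    inner ℝ c z + r ≤ (supportFn S c).toReal := by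
  have h1 := inner_le_toReal_supportFn hS
    (h (show z + r • c ∈ _ by simp [norm_smul, hc, abs_of_nonneg hr])) c
  rwa [inner_add_right, inner_smul_right, real_inner_self_eq_norm_sq, hc, one_pow, mul_one] at h1

/-- A strict lower bound on jointly continuous support functions in all unit directions persists
for nearby times. -/
theorem eventually_forall_unit_lt {T : ℝ} {Y : ℝ → Set (Rn n)} (hYc : SupportContinuous T Y)
    (hY : CompactConvexValued T Y) (hne : ∀ t ∈ Icc (0 : ℝ) T, (Y t).Nonempty) {t₀ : ℝ}
    {z : Rn n} {ρ : ℝ} (h : ∀ c : Rn n, ‖c‖ = 1 → inner ℝ c z + ρ < supportFnTime Y c t₀) :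
    ∀ᶠ t in 𝓝 t₀, t ∈ Icc 0 T → ∀ c : Rn n, ‖c‖ = 1 → inner ℝ c z + ρ < supportFnTime Y c t := by
  have hcl := (isCompact_setOf_exists_unit_nonneg
    (H := fun p : ℝ × Rn n => inner ℝ p.2 z + ρ - supportFnTime Y p.2 p.1)
    (ContinuousOn.sub (by fun_prop) (hYc.continuousOn_uncurry hY hne))).isClosed
  filter_upwards [hcl.isOpen_compl.mem_nhds (x := t₀) (by
    rintro ⟨-, c, hc, hn⟩
    have := h c hc
    simp only at hn
    linarith)] with t ht htT c hc
  by_contra! hcon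
  exact ht ⟨htT, c, hc, by linarith⟩

/-- Invariance of `Y` along a Lipschitz curve in `Z`, on the whole time horizon. -/
theorem forall_mem_of_facet_velocity_le {T : ℝ} {Y Z : ℝ → Set (Rn n)}
    (hY : CompactConvexValued T Y) (hZ : CompactConvexValued T Z)
    (hYlip : SupportLipschitz T Y) (hZcont : SupportContinuous T Z)
    (hYZ : ∀ t ∈ Icc (0 : ℝ) T, (Y t ∩ interior (Z t)).Nonempty)
    {x : ℝ → Rn n} {L : NNReal} (hx : LipschitzOnWith L x (Icc 0 T))
    (hxZ : ∀ t ∈ Icc (0 : ℝ) T, x t ∈ Z t) (hx0 : x 0 ∈ Y 0) {φ : ℝ → Rn n → Rn n}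
    (hφ : ∀ R : ℝ, ∃ K M : ℝ, 0 ≤ K ∧ ∀ᵐ t ∂(volume.restrict (Icc (0 : ℝ) T)),
      (∀ ξ η, ‖ξ‖ ≤ R → ‖η‖ ≤ R → ‖φ t ξ - φ t η‖ ≤ K * ‖ξ - η‖) ∧
      (∀ ξ, ‖ξ‖ ≤ R → ‖φ t ξ‖ ≤ M))
    (hder : ∀ᵐ t ∂(volume.restrict (Icc (0 : ℝ) T)), HasDerivAt x (φ t (x t)) t)
    (hfac : ∀ᵐ t ∂(volume.restrict (Icc (0 : ℝ) T)), ∀ c : Rn n, ∀ ξ ∈ Y t ∩ interior (Z t),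
      inner ℝ c ξ = supportFnTime Y c t →
        ((inner ℝ c (φ t ξ) : ℝ) : EReal) ≤ lowerDini (supportFnTime Y c) t) :
    ∀ t ∈ Icc (0 : ℝ) T, x t ∈ Y t := by
  have hYne : ∀ t ∈ Icc (0 : ℝ) T, (Y t).Nonempty := fun t ht => (hYZ t ht).mono inter_subset_left
  have hZne : ∀ t ∈ Icc (0 : ℝ) T, (Z t).Nonempty := fun t ht => ⟨x t, hxZ t ht⟩
  have hYcont := hYlip.supportContinuous
  have hV := hYcont.continuousOn_uncurry hY hYne
  obtain ⟨R₁, hR₁⟩ := hYcont.exists_norm_le hY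
  obtain ⟨R₂, hR₂⟩ := hZcont.exists_norm_le hZ
  obtain ⟨K, M, hK, hKM⟩ := hφ (max R₁ R₂)
  have hall := (ae_restrict_iff' measurableSet_Icc).1 (hKM.and (hder.and hfac))
  -- Continuous induction: the set of good times is closed, and it remains to move a little to the
  -- right of each of its points.
  have hclosed : IsClosed ({t | x t ∈ Y t} ∩ Icc 0 T) := by
    have : {t | x t ∈ Y t} ∩ Icc 0 T = Icc 0 T ∩ ⋂ c : Rn n, ⋂ _ : ‖c‖ = 1,
        (Icc 0 T ∩ (fun t => supportFnTime Y c t - inner ℝ c (x t)) ⁻¹' Ici 0 ) := by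
      ext t
      simp only [mem_inter_iff, mem_ofPred_eq, mem_iInter, mem_preimage, mem_Ici, sub_nonneg]
      constructor
      · rintro ⟨h1, h2⟩
        exact ⟨h2, fun c _ => ⟨h2, inner_le_toReal_supportFn (hY t h2).1 h1 c⟩⟩
      · rintro ⟨h1, h2⟩
        exact ⟨mem_of_forall_unit_inner_le_supportFn (hY t h1).1 (hY t h1).2 (hYne t h1)
          fun c hc => (h2 c hc).2, h1⟩
    rw [this]
    refine isClosed_Icc.inter (isClosed_iInter fun c => isClosed_iInter fun _ => ?_)
    refine ContinuousOn.preimage_isClosed_of_isClosed ?_ isClosed_Icc isClosed_Ici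
    exact (hYcont c).sub (continuousOn_const.inner hx.continuousOn)
  refine hclosed.Icc_subset_of_forall_mem_nhdsWithin hx0 ?_
  rintro a ⟨haY, ha⟩
  have haT : a ∈ Icc 0 T := ⟨ha.1, ha.2.le⟩
  obtain ⟨z, hzY, hzZ⟩ := hYZ a haT
  obtain ⟨ρ, hρ, hball⟩ := Metric.isOpen_iff.1 isOpen_interior z hzZ
  -- At time `a` the ball of radius `2 * r` lies in `Z a`. Nearby, radius `3 / 2 * r` survives,
  -- leaving room for radius `r` in the interior; likewise `z ∈ Y a` weakens to a defect `r / 2`,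
  -- which is why `D ≥ r / 2` is what the local result requires.
  set r := ρ / 3 with hr
  have hr0 : 0 < r := by positivity
  have hsub : Metric.closedBall z (2 * r) ⊆ Z a :=
    (Metric.closedBall_subset_ball (by linarith)).trans (hball.trans interior_subset)
  have hZev := eventually_forall_unit_lt hZcont hZ hZne (t₀ := a) (z := z) (ρ := 3 / 2 * r)
    fun c hc => by
      have := inner_add_le_supportFn_of_closedBall_subset (hZ a haT).1 (by positivity) hsub hc
      simp only [supportFnTime]
      linarith
  have hYev := eventually_forall_unit_lt hYcont hY hYne (t₀ := a) (z := z) (ρ := -(r / 2))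
    fun c hc => by
      have := inner_le_toReal_supportFn (hY a haT).1 hzY c
      simp only [supportFnTime]
      linarith
  obtain ⟨δ, hδ, hδall⟩ := Metric.eventually_nhds_iff.1 (hZev.and hYev)
  have hb : a < min T (a + δ / 2) := lt_min ha.2 (by linarith)
  have hsubT : Icc a (min T (a + δ / 2)) ⊆ Icc 0 T := fun t ht =>
    ⟨ha.1.trans ht.1, ht.2.trans (min_le_left _ _)⟩
  have hnear : ∀ t ∈ Icc a (min T (a + δ / 2)), dist t a < δ := fun t ht => by
    have := ht.2.trans (min_le_right _ _)
    rw [Real.dist_eq, abs_lt]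
    constructor <;> linarith [ht.1]
  have hmem := mem_of_facet_velocity_le (a := a) (b := min T (a + δ / 2)) (Y := Y) (Z := Z)
    (fun t ht => hY t (hsubT ht)) (fun t ht => hYne t (hsubT ht)) (fun t ht => (hZ t (hsubT ht)).2)
    (fun c => (hYlip c).imp fun _ h => h.mono hsubT) (hV.mono (prod_mono_left hsubT))
    (hx.mono hsubT) (fun t ht => hxZ t (hsubT ht)) haY (z := z) hr0
    (fun t ht => by
      have hb1 : Metric.closedBall z (3 / 2 * r) ⊆ Z t :=
        closedBall_subset_of_supportFn (hZ t (hsubT ht)).1 (hZ t (hsubT ht)).2 (hZne t (hsubT ht))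
          fun c hc => ((hδall (hnear t ht)).1 (hsubT ht) c hc).le
      exact (Metric.closedBall_subset_ball (by linarith)).trans
        (interior_maximal (Metric.ball_subset_closedBall.trans hb1) Metric.isOpen_ball))
    (fun t ht c hc => by
      have := (hδall (hnear t ht)).2 (hsubT ht) c hc
      linarith)
    (R := max R₁ R₂) (fun t ht y hy => (hR₁ t (hsubT ht) y hy).trans (le_max_left _ _))
    (fun t ht => (hR₂ t (hsubT ht) _ (hxZ t (hsubT ht))).trans (le_max_right _ _))
    (ae_iff.1 hall) hK (φ := φ) (fun t ht htN => by
      obtain ⟨⟨h1, h2⟩, h3, h4⟩ := not_not.1 htN (hsubT ht)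
      exact ⟨h1, h2, h3.hasDerivWithinAt, fun c ξ hξ hc q hq =>
        eventually_le_sub_of_le_lowerDini (h4 c ξ hξ hc) hq⟩)
  exact mem_of_superset (Icc_mem_nhdsGT hb) hmem

end Global

/-! ### Regularity of trajectories, and time reversal. -/

section Trajectories

variable {n m : ℕ}

/-- On compact sets of states and controls the right-hand side is Lipschitz in the state. -/
theorem RhsRegular.exists_lipschitz {f : Rn n → Rn m → Rn m → Rn n} (hf : RhsRegular f)
    {C : Set (Rn n)} (hC : IsCompact C) {U₁ U₂ : Set (Rn m)} (hU₁ : IsCompact U₁)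
    (hU₂ : IsCompact U₂) :
    ∃ K : ℝ, 0 ≤ K ∧ ∀ x ∈ C, ∀ y ∈ C, ∀ a ∈ U₁, ∀ b ∈ U₂,
      ‖f x a b - f y a b‖ ≤ K * ‖x - y‖ := by
  set p : Set (Rn n × Rn n × Rn m × Rn m) → Prop := fun S => ∃ K : ℝ, 0 ≤ K ∧ ∀ q ∈ S,
    ‖f q.1 q.2.2.1 q.2.2.2 - f q.2.1 q.2.2.1 q.2.2.2‖ ≤ K * ‖q.1 - q.2.1‖ with hp
  have hcomp : IsCompact (C ×ˢ C ×ˢ U₁ ×ˢ U₂) := hC.prod (hC.prod (hU₁.prod hU₂))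
  have hc1 : Continuous (fun q : Rn n × Rn n × Rn m × Rn m => f q.1 q.2.2.1 q.2.2.2) :=
    hf.1.comp (g := fun p : Rn n × Rn m × Rn m => f p.1 p.2.1 p.2.2)
      (f := fun q : Rn n × Rn n × Rn m × Rn m => (q.1, q.2.2.1, q.2.2.2)) (by fun_prop)
  have hc2 : Continuous (fun q : Rn n × Rn n × Rn m × Rn m => f q.2.1 q.2.2.1 q.2.2.2) :=
    hf.1.comp (g := fun p : Rn n × Rn m × Rn m => f p.1 p.2.1 p.2.2)
      (f := fun q : Rn n × Rn n × Rn m × Rn m => (q.2.1, q.2.2.1, q.2.2.2)) (by fun_prop)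
  have hmain : p (C ×ˢ C ×ˢ U₁ ×ˢ U₂) := by
    refine hcomp.induction_on ⟨0, le_rfl, by simp⟩ ?_ ?_ ?_
    · rintro s t hst ⟨K, hK, h⟩
      exact ⟨K, hK, fun q hq => h q (hst hq)⟩
    · rintro s t ⟨K, hK, h⟩ ⟨K', hK', h'⟩
      refine ⟨max K K', hK.trans (le_max_left _ _), ?_⟩
      rintro q (hq | hq)
      · exact (h q hq).trans (mul_le_mul_of_nonneg_right (le_max_left _ _) (norm_nonneg _))
      · exact (h' q hq).trans (mul_le_mul_of_nonneg_right (le_max_right _ _) (norm_nonneg _))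
    · rintro ⟨x, y, a, b⟩ -
      -- `C` need not be convex, so local constants cannot be chained along segments. Near the
      -- diagonal the local hypothesis applies; away from it `‖x - y‖` is bounded below and
      -- continuity bounds the quotient.
      by_cases hxy : x = y
      · subst hxy
        obtain ⟨K, S, hS, h⟩ := hf.2 (x, a, b)
        have t1 : Tendsto (fun q : Rn n × Rn n × Rn m × Rn m => (q.1, q.2.2.1, q.2.2.2))
            (𝓝 (x, x, a, b)) (𝓝 (x, a, b)) := Continuous.tendsto' (by fun_prop) _ _ rfl
        have t2 : Tendsto (fun q : Rn n × Rn n × Rn m × Rn m => (q.2.1, q.2.2.1, q.2.2.2))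
            (𝓝 (x, x, a, b)) (𝓝 (x, a, b)) := Continuous.tendsto' (by fun_prop) _ _ rfl
        refine ⟨_, mem_nhdsWithin_of_mem_nhds (inter_mem (t1 hS) (t2 hS)), max K 0,
          le_max_right _ _, fun q hq => ?_⟩
        exact (h _ _ _ _ hq.1 hq.2).trans
          (mul_le_mul_of_nonneg_right (le_max_left _ _) (norm_nonneg _))
      · have hpos : 0 < ‖x - y‖ := norm_pos_iff.2 (sub_ne_zero.2 hxy)
        have e1 : ∀ᶠ q : Rn n × Rn n × Rn m × Rn m in 𝓝 (x, y, a, b),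
            ‖x - y‖ / 2 < ‖q.1 - q.2.1‖ :=
          Tendsto.eventually_const_lt (half_lt_self hpos)
            (Continuous.tendsto' (by fun_prop) _ _ rfl)
        have e2 : ∀ᶠ q : Rn n × Rn n × Rn m × Rn m in 𝓝 (x, y, a, b),
            ‖f q.1 q.2.2.1 q.2.2.2 - f q.2.1 q.2.2.1 q.2.2.2‖ < ‖f x a b - f y a b‖ + 1 :=
          Tendsto.eventually_lt_const (lt_add_one _)
            (Continuous.tendsto' (hc1.sub hc2).norm _ _ rfl)
        refine ⟨_, mem_nhdsWithin_of_mem_nhds (e1.and e2),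
          (‖f x a b - f y a b‖ + 1) / (‖x - y‖ / 2), by positivity, fun q hq => ?_⟩
        refine hq.2.le.trans ?_
        rw [div_mul_eq_mul_div, le_div_iff₀ (by positivity)]
        exact mul_le_mul_of_nonneg_left hq.1.le (by positivity)
  obtain ⟨K, hK, h⟩ := hmain
  exact ⟨K, hK, fun x hx y hy a ha b hb => h (x, y, a, b) ⟨hx, hy, ha, hb⟩⟩

theorem RhsRegular.exists_bound {f : Rn n → Rn m → Rn m → Rn n} (hf : RhsRegular f)
    {C : Set (Rn n)} (hC : IsCompact C) {U₁ U₂ : Set (Rn m)} (hU₁ : IsCompact U₁)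
    (hU₂ : IsCompact U₂) :
    ∃ M : ℝ, ∀ x ∈ C, ∀ a ∈ U₁, ∀ b ∈ U₂, ‖f x a b‖ ≤ M := by
  obtain ⟨M, hM⟩ := (hC.prod (hU₁.prod hU₂)).exists_bound_of_continuousOn hf.1.continuousOn
  exact ⟨M, fun x hx a ha b hb => hM (x, a, b) ⟨hx, ha, hb⟩⟩

theorem HasW11Deriv.continuousOn {T : ℝ} {x v : ℝ → Rn n} (h : HasW11Deriv T x v) :
    ContinuousOn x (Icc 0 T) := by
  by_cases hT : 0 ≤ T
  · have h1 := intervalIntegral.continuousOn_primitive_interval (μ := volume) (f := v)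
      (a := 0) (b := T) (by rw [uIcc_of_le hT]; exact h.1)
    rw [uIcc_of_le hT] at h1
    exact (continuousOn_const.add h1).congr h.2
  · rw [Icc_eq_empty hT]
    exact continuousOn_empty _

theorem HasW11Deriv.lipschitzOnWith {T : ℝ} {x v : ℝ → Rn n} (h : HasW11Deriv T x v)
    {C : NNReal} (hC : ∀ᵐ t ∂(volume.restrict (Icc (0 : ℝ) T)), ‖v t‖ ≤ C) :
    LipschitzOnWith C x (Icc 0 T) := by
  refine LipschitzOnWith.of_dist_le_mul fun t ht s hs => ?_
  have hT : 0 ≤ T := ht.1.trans ht.2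
  have hint : ∀ r ∈ Icc 0 T, IntervalIntegrable v volume 0 r := fun r hr =>
    IntegrableOn.intervalIntegrable
      (h.1.mono_set (by rw [uIcc_of_le hr.1]; exact Icc_subset_Icc_right hr.2))
  rw [h.2 t ht, h.2 s hs, dist_add_left, dist_eq_norm,
    intervalIntegral.integral_interval_sub_left (hint t ht) (hint s hs), Real.dist_eq]
  refine intervalIntegral.norm_integral_le_of_norm_le_const_ae ?_
  filter_upwards [(ae_restrict_iff' measurableSet_Icc).1 hC] with r hr hrI
  exact hr (uIcc_subset_Icc hs ht (uIoc_subset_uIcc hrI))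

theorem HasW11Deriv.ae_hasDerivAt {T : ℝ} {x v : ℝ → Rn n} (hT : 0 ≤ T) (h : HasW11Deriv T x v) :
    ∀ᵐ t ∂(volume.restrict (Icc (0 : ℝ) T)), HasDerivAt x (v t) t := by
  have hint : IntervalIntegrable v volume 0 T :=
    IntegrableOn.intervalIntegrable (by rw [uIcc_of_le hT]; exact h.1)
  rw [← restrict_Ioo_eq_restrict_Icc, ae_restrict_iff' measurableSet_Ioo]
  filter_upwards [hint.ae_hasDerivAt_integral] with t ht htI
  rw [uIcc_of_le hT] at ht
  refine ((ht (Ioo_subset_Icc_self htI) 0 (left_mem_Icc.2 hT)).const_add (x 0)).congr_of_eventuallyEq ?_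
  filter_upwards [Icc_mem_nhds htI.1 htI.2] with s hs
  exact h.2 s hs

theorem ae_restrict_Icc_reflect {T : ℝ} {p : ℝ → Prop}
    (h : ∀ᵐ t ∂(volume.restrict (Icc (0 : ℝ) T)), p t) :
    ∀ᵐ t ∂(volume.restrict (Icc (0 : ℝ) T)), p (T - t) := by
  rw [ae_restrict_iff' measurableSet_Icc] at h ⊢
  filter_upwards [(Measure.measurePreserving_sub_left volume T).quasiMeasurePreserving.ae h] with t ht htI
  exact ht ⟨by linarith [htI.2], by linarith [htI.1]⟩

/-- Reflection of time flips the sign of difference quotients and thus exchanges lower and upper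
limits. This is why the backward enclosure is governed by the upper Dini derivative. -/
theorem lowerDini_reflect (g : ℝ → ℝ) (T t : ℝ) :
    -upperDini g (T - t) ≤ lowerDini (fun s => g (T - s)) t := by
  have htend : Tendsto (fun s => T - s) (𝓝[≠] t) (𝓝[≠] (T - t)) := by
    refine tendsto_nhdsWithin_iff.2 ⟨(Continuous.tendsto (by fun_prop) t).mono_left
      nhdsWithin_le_nhds, ?_⟩
    filter_upwards [self_mem_nhdsWithin] with s hs h
    exact hs (sub_right_injective h)
  rw [upperDini, ← EReal.liminf_neg, lowerDini]
  refine (liminf_le_liminf_of_le htend).trans_eq ?_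
  rw [← liminf_comp]
  congr 1
  ext s
  simp only [Function.comp, Pi.neg_apply]
  rw [← EReal.coe_neg, ← div_neg]
  congr 3
  ring

theorem SupportLipschitz.reflect {T : ℝ} {Y : ℝ → Set (Rn n)} (h : SupportLipschitz T Y) :
    SupportLipschitz T (fun t => Y (T - t)) := by
  intro c
  obtain ⟨L, hL⟩ := h c
  refine ⟨L, LipschitzOnWith.of_dist_le_mul fun t ht s hs => ?_⟩
  have := hL.dist_le_mul (T - t) ⟨by linarith [ht.2], by linarith [ht.1]⟩ (T - s)
    ⟨by linarith [hs.2], by linarith [hs.1]⟩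
  rwa [dist_sub_left] at this

theorem SupportContinuous.reflect {T : ℝ} {Y : ℝ → Set (Rn n)} (h : SupportContinuous T Y) :
    SupportContinuous T (fun t => Y (T - t)) := fun c =>
  (h c).comp (f := fun t => T - t) (by fun_prop) fun t ht =>
    ⟨by linarith [ht.2], by linarith [ht.1]⟩

/-- A state constraint that holds almost everywhere along a continuous curve holds everywhere. -/
theorem forall_mem_of_ae_mem {T : ℝ} (hT : 0 < T) {X : ℝ → Set (Rn n)}
    (hX : CompactConvexValued T X) (hXne : ∀ t ∈ Icc (0 : ℝ) T, (X t).Nonempty)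
    (hXc : SupportContinuous T X) {x : ℝ → Rn n} (hx : ContinuousOn x (Icc 0 T))
    (h : ∀ᵐ t ∂(volume.restrict (Icc (0 : ℝ) T)), x t ∈ X t) :
    ∀ t ∈ Icc (0 : ℝ) T, x t ∈ X t := by
  -- A set of full measure is dense, and each support inequality is a closed condition on time.
  have hdense : Icc 0 T ⊆ closure ({t | t ∈ Ioo 0 T → x t ∈ X t} ∩ Ioo 0 T) := by
    rw [← restrict_Ioo_eq_restrict_Icc, ae_restrict_iff' measurableSet_Ioo] at h
    have hd : Dense {t | t ∈ Ioo 0 T → x t ∈ X t} := Measure.dense_of_ae h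
    rw [← closure_Ioo hT.ne]
    exact closure_minimal (by rw [inter_comm]; exact hd.open_subset_closure_inter isOpen_Ioo)
      isClosed_closure
  intro t ht
  refine mem_of_forall_unit_inner_le_supportFn (hX t ht).1 (hX t ht).2 (hXne t ht) fun c _ => ?_
  have hcl : IsClosed (Icc 0 T ∩ (fun t => supportFnTime X c t - inner ℝ c (x t)) ⁻¹' Ici 0) :=
    ((hXc c).sub (continuousOn_const.inner hx)).preimage_isClosed_of_isClosed isClosed_Icc
      isClosed_Ici
  have hsub : {t | t ∈ Ioo 0 T → x t ∈ X t} ∩ Ioo 0 T ⊆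
      Icc 0 T ∩ (fun t => supportFnTime X c t - inner ℝ c (x t)) ⁻¹' Ici 0 := fun s hs =>
    ⟨Ioo_subset_Icc_self hs.2, sub_nonneg.2
      (inner_le_toReal_supportFn (hX s (Ioo_subset_Icc_self hs.2)).1 (hs.1 hs.2) c)⟩
  exact sub_nonneg.1 ((closure_minimal hsub hcl) (hdense ht)).2

end Trajectories

/-! ### The enclosure theorem: backward invariance, then forward invariance. -/

theorem theorem2 {n m : ℕ} (T : ℝ) (hT : 0 < T)
    (f : Rn n → Rn m → Rn m → Rn n) (hf : RhsRegular f)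
    (U₁ U₂ : Set (Rn m))
    (hU₁ : U₁.Nonempty ∧ Convex ℝ U₁ ∧ IsCompact U₁)
    (hU₂ : U₂.Nonempty ∧ Convex ℝ U₂ ∧ IsCompact U₂)
    (x₀ : Rn n)
    (u₁ : ℝ → Rn m) (hu₁ : IntegrableOn u₁ (Icc 0 T) volume)
    (hu₁U : ∀ t ∈ Icc (0 : ℝ) T, u₁ t ∈ U₁)
    (X₂ YB YF : ℝ → Set (Rn n))
    (hX₂ : CompactConvexValued T X₂) (hYB : CompactConvexValued T YB)
    (hYF : CompactConvexValued T YF)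
    (hX₂cont : SupportContinuous T X₂)
    (hYBlip : SupportLipschitz T YB) (hYFlip : SupportLipschitz T YF)
    (hBX : ∀ t ∈ Icc (0 : ℝ) T, (YB t ∩ interior (X₂ t)).Nonempty)
    (hFB : ∀ t ∈ Icc (0 : ℝ) T, (YF t ∩ interior (YB t)).Nonempty)
    (hBineq : ∀ᵐ t ∂(volume.restrict (Icc (0 : ℝ) T)), ∀ c : Rn n,
      upperDini (supportFnTime YB c) t ≤
        -supportFn (-velocitySet f U₂ (u₁ t) c (YB t) (X₂ t)) c)
    (hFineq : ∀ᵐ t ∂(volume.restrict (Icc (0 : ℝ) T)), ∀ c : Rn n,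
      supportFn (velocitySet f U₂ (u₁ t) c (YF t) (YB t)) c ≤
        lowerDini (supportFnTime YF c) t)
    (hF0 : ∀ c : Rn n, ((inner ℝ c x₀ : ℝ) : EReal) ≤ supportFn (YF 0) c)
    (hBT : ∀ c : Rn n, supportFn (X₂ T) c ≤ supportFn (YB T) c) :
    IsEnclosure T (fun t => YF t ∩ YB t) (reachableSet f U₂ X₂ x₀ T u₁) := by
  refine ⟨fun t ht => ⟨(hYF t ht).1.inter (hYB t ht).1, (hYF t ht).2.inter (hYB t ht).2⟩, ?_⟩
  rintro t₀ ht₀ _ ⟨x, ⟨v, u₂, hxv, -, hae, hx0⟩, rfl⟩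
  have hIcc : ∀ t ∈ Icc 0 T, T - t ∈ Icc 0 T := fun t ht =>
    ⟨by linarith [ht.2], by linarith [ht.1]⟩
  have h0T : (0 : ℝ) ∈ Icc 0 T := left_mem_Icc.2 hT.le
  have hTT : T ∈ Icc 0 T := right_mem_Icc.2 hT.le
  have hXne : ∀ t ∈ Icc (0 : ℝ) T, (X₂ t).Nonempty := fun t ht =>
    (hBX t ht).mono (inter_subset_right.trans interior_subset)
  have hBne : ∀ t ∈ Icc (0 : ℝ) T, (YB t).Nonempty := fun t ht => (hBX t ht).mono inter_subset_left
  have hFne : ∀ t ∈ Icc (0 : ℝ) T, (YF t).Nonempty := fun t ht => (hFB t ht).mono inter_subset_left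
  have hu₁ae : ∀ᵐ t ∂(volume.restrict (Icc (0 : ℝ) T)), u₁ t ∈ U₁ :=
    (ae_restrict_iff' measurableSet_Icc).2 (Eventually.of_forall hu₁U)
  have hxX : ∀ t ∈ Icc (0 : ℝ) T, x t ∈ X₂ t :=
    forall_mem_of_ae_mem hT hX₂ hXne hX₂cont hxv.continuousOn (hae.mono fun t h => h.2.1)
  have hbounds : ∀ R : ℝ, ∃ K M : ℝ, 0 ≤ K ∧ ∀ᵐ t ∂(volume.restrict (Icc (0 : ℝ) T)),
      (∀ ξ η, ‖ξ‖ ≤ R → ‖η‖ ≤ R → ‖f ξ (u₁ t) (u₂ t) - f η (u₁ t) (u₂ t)‖ ≤ K * ‖ξ - η‖) ∧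
      (∀ ξ, ‖ξ‖ ≤ R → ‖f ξ (u₁ t) (u₂ t)‖ ≤ M) := by
    intro R
    have hC := isCompact_closedBall (0 : Rn n) R
    obtain ⟨K, hK, hKf⟩ := hf.exists_lipschitz hC hU₁.2.2 hU₂.2.2
    obtain ⟨M, hM⟩ := hf.exists_bound hC hU₁.2.2 hU₂.2.2
    refine ⟨K, M, hK, ?_⟩
    filter_upwards [hae, hu₁ae] with t ht ht1
    exact ⟨fun ξ η hξ hη => hKf ξ (by simpa using hξ) η (by simpa using hη) _ ht1 _ ht.2.2,
      fun ξ hξ => hM ξ (by simpa using hξ) _ ht1 _ ht.2.2⟩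
  -- The trajectory is bounded, being continuous on a compact interval; hence its velocity is
  -- essentially bounded.
  obtain ⟨L, hL⟩ : ∃ L : NNReal, LipschitzOnWith L x (Icc 0 T) := by
    obtain ⟨R, hR⟩ := isCompact_Icc.exists_bound_of_continuousOn hxv.continuousOn
    obtain ⟨K, M, -, hKM⟩ := hbounds R
    refine ⟨M.toNNReal, hxv.lipschitzOnWith ?_⟩
    filter_upwards [hKM, hae, ae_restrict_mem measurableSet_Icc] with t h1 h2 ht
    rw [h2.1]
    exact (h1.2 _ (hR t ht)).trans (Real.le_coe_toNNReal M)
  have hder : ∀ᵐ t ∂(volume.restrict (Icc (0 : ℝ) T)), HasDerivAt x (f (x t) (u₁ t) (u₂ t)) t := by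
    filter_upwards [hxv.ae_hasDerivAt hT.le, hae] with t h1 h2
    rwa [← h2.1]
  have hxB : ∀ t ∈ Icc (0 : ℝ) T, x t ∈ YB t := by
    -- In reversed time the velocity is `-f`, and the terminal condition at `T` becomes the initial
    -- condition.
    have hrev := forall_mem_of_facet_velocity_le (T := T) (Y := fun t => YB (T - t))
      (Z := fun t => X₂ (T - t)) (fun t ht => hYB _ (hIcc t ht)) (fun t ht => hX₂ _ (hIcc t ht))
      hYBlip.reflect hX₂cont.reflect (fun t ht => hBX _ (hIcc t ht)) (x := fun t => x (T - t))
      (L := L) (LipschitzOnWith.of_dist_le_mul fun t ht s hs => by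
        have := hL.dist_le_mul _ (hIcc t ht) _ (hIcc s hs)
        rwa [dist_sub_left] at this)
      (fun t ht => hxX _ (hIcc t ht))
      (by
        simp only [sub_zero]
        refine mem_of_forall_unit_inner_le_supportFn (hYB T hTT).1 (hYB T hTT).2 (hBne T hTT)
          fun c _ => (inner_le_toReal_supportFn (hX₂ T hTT).1 (hxX T hTT) c).trans ?_
        have := hBT c
        rwa [← coe_toReal_supportFn (hX₂ T hTT).1 (hXne T hTT),
          ← coe_toReal_supportFn (hYB T hTT).1 (hBne T hTT), EReal.coe_le_coe_iff] at this)
      (φ := fun t ξ => -f ξ (u₁ (T - t)) (u₂ (T - t)))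
      (fun R => by
        obtain ⟨K, M, hK, h⟩ := hbounds R
        refine ⟨K, M, hK, (ae_restrict_Icc_reflect h).mono fun t ht => ⟨?_, ?_⟩⟩
        · intro ξ η hξ hη
          rw [neg_sub_neg, norm_sub_rev]
          exact ht.1 ξ η hξ hη
        · intro ξ hξ
          rw [norm_neg]
          exact ht.2 ξ hξ)
      ((ae_restrict_Icc_reflect hder).mono fun t ht => by
        have := ht.scomp t ((hasDerivAt_id t).const_sub T)
        simpa [Function.comp_def] using this)
      (by
        filter_upwards [ae_restrict_Icc_reflect hBineq, ae_restrict_Icc_reflect hae,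
          ae_restrict_mem measurableSet_Icc] with t h1 h2 ht c ξ hξ hc
        refine le_trans ?_ (lowerDini_reflect (supportFnTime YB c) T t)
        refine le_trans ?_ (EReal.le_neg_of_le_neg (h1 c))
        refine le_iSup₂_of_le (-f ξ (u₁ (T - t)) (u₂ (T - t))) ?_ le_rfl
        rw [Set.neg_mem_neg]
        refine ⟨ξ, _, ?_, hξ, h2.2.2, rfl⟩
        rw [hc]
        exact coe_toReal_supportFn (hYB _ (hIcc t ht)).1 (hBne _ (hIcc t ht)) c)
    intro t ht
    have := hrev _ (hIcc t ht)
    simpa using this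
  refine ⟨?_, hxB t₀ ht₀⟩
  -- The inclusion `hxB` just obtained is the state constraint here, so only facet points interior
  -- to `YB` have to be tested.
  refine forall_mem_of_facet_velocity_le hYF hYB hYFlip hYBlip.supportContinuous hFB hL hxB ?_
    hbounds hder ?_ t₀ ht₀
  · rw [hx0]
    refine mem_of_forall_unit_inner_le_supportFn (hYF 0 h0T).1 (hYF 0 h0T).2 (hFne 0 h0T)
      fun c _ => ?_
    have := hF0 c
    rwa [← coe_toReal_supportFn (hYF 0 h0T).1 (hFne 0 h0T), EReal.coe_le_coe_iff] at this
  · filter_upwards [hFineq, hae, ae_restrict_mem measurableSet_Icc] with t h1 h2 ht c ξ hξ hc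
    refine le_trans ?_ (h1 c)
    refine le_iSup₂_of_le (f ξ (u₁ t) (u₂ t)) ⟨ξ, _, ?_, hξ, h2.2.2, rfl⟩ le_rfl
    rw [hc]
    exact coe_toReal_supportFn (hYF t ht).1 (hFne t ht) c
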